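/- For a positive integer $j$ let $f_j := \prod_{n=1}^{\infty}(1-q^{jn})$, regarded as a formal power series in $q$ with integer coefficients (it has constant term $1$, hence is invertible in $\mathbb{Z}[[q]]$). Let $S$ be any finite set of positive integers, let $n_j\in\mathbb{Z}$ for $j\in S$, and let $$A(q) = f_1 \prod_{j\in S} \left( \frac{f_j^2}{f_{2j}} \right)^{n_j} =: \sum_{n=0}^{\infty}a_nq^n, \qquad B(q) = A(q)\, \frac{f_1^2 f_3^2}{f_2f_6} =: \sum_{n=0}^{\infty}b_nq^n.$$ Then for every integer $n\ge 0$: (i) if $a_n\equiv 0 \pmod 2$, or if $n=\frac{t(3t-1)}{2}$ for some even $t\in\mathbb{Z}$, then $b_n\equiv a_n \pmod 4$; (ii) if $n=\frac{t(3t-1)}{2}$ for some odd $t\in\mathbb{Z}$, then $b_n\equiv a_n+2 \pmod 4$. -/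

import Mathlib

open scoped PowerSeries PowerSeries.WithPiTopology

namespace EtaQuotient

/-- The Euler product `f_j = ∏_{n ≥ 1} (1 - q ^ (j n))` (with `q = PowerSeries.X`) as a formal
power series with integer coefficients. The infinite product is taken in the usual topology of
coefficientwise convergence (`ℤ` being discrete). -/
noncomputable def eulerProd (j : ℕ+) : ℤ⟦X⟧ :=
  ∏' n : ℕ, (1 - (PowerSeries.X : ℤ⟦X⟧) ^ ((j : ℕ) * (n + 1)))

/-- The infinite product defining `eulerProd j` converges. -/
theorem multipliable_eulerProd (j : ℕ+) :
    Multipliable fun n : ℕ ↦ 1 - (PowerSeries.X : ℤ⟦X⟧) ^ ((j : ℕ) * (n + 1)) := by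
  simp_rw [sub_eq_add_neg]
  apply PowerSeries.WithPiTopology.multipliable_one_add_of_tendsto_order_atTop_nhds_top
  refine ENat.tendsto_nhds_top_iff_natCast_lt.mpr
    fun n ↦ Filter.eventually_atTop.mpr ⟨n, fun m hm ↦ ?_⟩
  rw [PowerSeries.order_neg, PowerSeries.order_X_pow]
  norm_cast
  have := j.pos
  nlinarith

theorem constantCoeff_eulerProd (j : ℕ+) : PowerSeries.constantCoeff (eulerProd j) = 1 := by
  rw [eulerProd, (multipliable_eulerProd j).map_tprod _
    (PowerSeries.WithPiTopology.continuous_constantCoeff ℤ)]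
  simp

theorem isUnit_eulerProd (j : ℕ+) : IsUnit (eulerProd j) := by
  rw [PowerSeries.isUnit_iff_constantCoeff, constantCoeff_eulerProd]
  exact isUnit_one

/-- `f_j` as an element of the (commutative) group of invertible formal power series over `ℤ`, in
which quotients and integer powers of the `f_j` are formed. -/
noncomputable def f (j : ℕ+) : ℤ⟦X⟧ˣ := (isUnit_eulerProd j).unit

/-- `A(q) = f_1 ∏_{j ∈ S} (f_j ^ 2 / f_{2j}) ^ {n_j}`, where `e j` is the integer `n_j`. -/
noncomputable def seriesA (S : Finset ℕ+) (e : ℕ+ → ℤ) : ℤ⟦X⟧ˣ :=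
  f 1 * ∏ j ∈ S, (f j ^ 2 / f (2 * j)) ^ e j

/-- `B(q) = A(q) f_1 ^ 2 f_3 ^ 2 / (f_2 f_6)`. -/
noncomputable def seriesB (S : Finset ℕ+) (e : ℕ+ → ℤ) : ℤ⟦X⟧ˣ :=
  seriesA S e * (f 1 ^ 2 * f 3 ^ 2 / (f 2 * f 6))

/-- The coefficient `a_n` of `q ^ n` in `A(q)`. -/
noncomputable def a (S : Finset ℕ+) (e : ℕ+ → ℤ) (n : ℕ) : ℤ :=
  PowerSeries.coeff n (seriesA S e : ℤ⟦X⟧)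

/-- The coefficient `b_n` of `q ^ n` in `B(q)`. -/
noncomputable def b (S : Finset ℕ+) (e : ℕ+ → ℤ) (n : ℕ) : ℤ :=
  PowerSeries.coeff n (seriesB S e : ℤ⟦X⟧)

end EtaQuotient

/-!
Write `θ = ∑_{t ∈ ℤ} q ^ (t (3 t - 1) / 2)`. The argument shows that `B - A ≡ θ - f_1` modulo `4`
(`exists_seriesB_sub_seriesA_eq`). By the pentagonal number theorem
`f_1 = ∑ (-1) ^ t q ^ (t (3 t - 1) / 2)`, so the coefficient of `q ^ n` in `θ - f_1` is `2` when
`n = t (3 t - 1) / 2` with `t` odd, and `0` otherwise. Moreover `A ≡ f_1` modulo `2`, so an even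
`a_n` forces `n` not to be a generalized pentagonal number.

For the congruence, `ψ_j = f_j ^ 2 / f_{2j}` is `1` modulo `2`, since squaring is additive in
characteristic `2` (`map_eulerProd_sq`). Thus `A ≡ f_1` modulo `2`, and as `ψ_1 ψ_3 - 1` is itself
even, `B - A = A (ψ_1 ψ_3 - 1) ≡ f_1 ψ_1 ψ_3 - f_1` modulo `4`. The product formula
`θ = f_2 f_3 ^ 2 / (f_1 f_6)` (`unsignedPentagonalSeries_mul`) gives `f_1 ψ_1 ψ_3 = θ ψ_1 ^ 2`, and
`ψ_1 ^ 2 ≡ 1` modulo `4`.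

The product formula is a case of the Jacobi triple product,
`θ = ∏ (1 + q ^ (3 k + 1)) (1 + q ^ (3 k + 2)) (1 - q ^ (3 k + 3))`. It is obtained from a finite
version (`prod_one_add_X_pow_eq_sum_gaussBinom`), which is the `q`-binomial theorem with shifted
variables. In the limit every Gaussian binomial coefficient in base `q ^ 3` near the middle of its
row tends to `1 / f_3` (`X_pow_dvd_gaussBinom_mul_eulerProd_sub_one`).
-/

open Filter Topology Finset

namespace EtaQuotient

/-! ### The finite Jacobi triple product -/

/-- The Gaussian binomial coefficient `[i + j, j]` in base `p`, indexed by the two parts `i`, `j`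
of its upper argument so that no subtraction is needed. -/
def gaussBinom {R : Type*} [CommRing R] (p : R) : ℕ → ℕ → R
  | 0, _ => 1
  | _ + 1, 0 => 1
  | i + 1, j + 1 => gaussBinom p i (j + 1) + p ^ (i + 1) * gaussBinom p (i + 1) j

section gaussBinom

variable {R : Type*} [CommRing R] (p : R)

@[simp]
theorem gaussBinom_zero_left (j : ℕ) : gaussBinom p 0 j = 1 := by
  rw [gaussBinom]

@[simp]
theorem gaussBinom_zero_right (i : ℕ) : gaussBinom p i 0 = 1 := by
  cases i <;> rw [gaussBinom]

theorem gaussBinom_succ_succ (i j : ℕ) : gaussBinom p (i + 1) (j + 1) =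
    gaussBinom p i (j + 1) + p ^ (i + 1) * gaussBinom p (i + 1) j := by
  rw [gaussBinom]

theorem gaussBinom_mul_prod_mul_prod (i j : ℕ) :
    gaussBinom p i j * (∏ k ∈ range i, (1 - p ^ (k + 1))) * ∏ k ∈ range j, (1 - p ^ (k + 1)) =
      ∏ k ∈ range (i + j), (1 - p ^ (k + 1)) := by
  induction i generalizing j with
  | zero => simp
  | succ i ihi =>
    induction j with
    | zero => simp
    | succ j ihj =>
      have h1 := ihi (j + 1)
      rw [show i + 1 + j = i + j + 1 by ring] at ihj
      rw [show i + (j + 1) = i + j + 1 by ring] at h1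
      rw [show i + 1 + (j + 1) = i + j + 1 + 1 by ring, gaussBinom_succ_succ, prod_range_succ _ i,
        prod_range_succ _ j, prod_range_succ _ (i + j + 1)]
      rw [prod_range_succ _ j] at h1
      rw [prod_range_succ _ i] at ihj
      linear_combination (1 - p ^ (i + 1)) * h1 + p ^ (i + 1) * (1 - p ^ (j + 1)) * ihj

/-- **The `q`-binomial theorem** (Rothe's identity), in homogeneous form. -/
theorem prod_add_mul_pow_eq_sum (x y : R) (m : ℕ) :
    ∏ k ∈ range m, (y + x * p ^ k) =
      ∑ ij ∈ antidiagonal m,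
        gaussBinom p ij.1 ij.2 * p ^ ij.2.choose 2 * x ^ ij.2 * y ^ ij.1 := by
  induction m with
  | zero => simp
  | succ m ih =>
    set t : ℕ × ℕ → R :=
      fun ij ↦ gaussBinom p ij.1 ij.2 * p ^ ij.2.choose 2 * x ^ ij.2 * y ^ ij.1 with ht
    -- The two halves of Pascal's rule for the summand, each vanishing on one side of the triangle.
    let s₁ : ℕ × ℕ → R := fun ij ↦ if ij.1 = 0 then 0 else y * t (ij.1 - 1, ij.2)
    let s₂ : ℕ × ℕ → R := fun ij ↦ if ij.2 = 0 then 0 else x * p ^ m * t (ij.1, ij.2 - 1)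
    have key : ∀ ij ∈ antidiagonal (m + 1), t ij = s₁ ij + s₂ ij := by
      rintro ⟨i, j⟩ hij
      rw [HasAntidiagonal.mem_antidiagonal] at hij
      rcases i with _ | i <;> rcases j with _ | j
      · simp at hij
      · obtain rfl : j = m := by simpa using hij
        simp [s₁, s₂, ht, Nat.choose_succ_succ' j 1]
        ring
      · simp [s₁, s₂, ht]
        ring
      · obtain rfl : m = i + j + 1 := by simp at hij; omega
        simp [s₁, s₂, ht, Nat.choose_succ_succ' j 1, gaussBinom_succ_succ]
        ring
    rw [sum_congr rfl key, sum_add_distrib, Nat.sum_antidiagonal_succ, Nat.sum_antidiagonal_succ',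
      prod_range_succ, ih]
    simp only [s₁, s₂, if_true, Nat.add_eq_zero_iff, one_ne_zero, and_false, if_false,
      Nat.add_sub_cancel, zero_add]
    rw [← mul_sum, ← mul_sum]
    simp only [Prod.mk.eta]
    ring

end gaussBinom

open PowerSeries in
/-- The Jacobi triple product `∏ (1 + q ^ (3 k + 1)) (1 + q ^ (3 k + 2)) (1 - q ^ (3 k + 3))`
before passage to the limit. -/
theorem prod_one_add_X_pow_eq_sum_gaussBinom (n : ℕ) :
    ∏ k ∈ range n, ((1 + X ^ (3 * k + 1)) * (1 + X ^ (3 * k + 2)) : ℤ⟦X⟧) =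
      ∑ ij ∈ antidiagonal (2 * n),
        gaussBinom (X ^ 3) ij.1 ij.2 * X ^ pentagonal ((ij.2 : ℤ) - n) := by
  set N := (∑ k ∈ range n, (3 * k + 1)) + 3 * n * n with hN
  have hN2 : 2 * (N : ℤ) = 3 * n * (n - 1) + 2 * n + 6 * n * n := by
    have hsum : ∀ n : ℕ, 2 * ((∑ k ∈ range n, (3 * k + 1) : ℕ) : ℤ) = 3 * n * (n - 1) + 2 * n := by
      intro n
      induction n with
      | zero => simp
      | succ n ih =>
        rw [sum_range_succ]
        push_cast at ih ⊢
        linear_combination ih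
    have := hsum n
    rw [hN]
    push_cast at this ⊢
    linear_combination this
  have hX : (X : ℤ⟦X⟧) ^ N ≠ 0 := pow_ne_zero _ X_ne_zero
  refine mul_left_cancel₀ hX ?_
  -- Both sides come from Rothe's identity with `y = q ^ (3 n)`, which makes it symmetric.
  have rothe := prod_add_mul_pow_eq_sum ((X : ℤ⟦X⟧) ^ 3) X (X ^ (3 * n)) (2 * n)
  have hl : ∏ k ∈ range (2 * n), ((X : ℤ⟦X⟧) ^ (3 * n) + X * (X ^ 3) ^ k) =
      X ^ N * ∏ k ∈ range n, ((1 + X ^ (3 * k + 1)) * (1 + X ^ (3 * k + 2)) : ℤ⟦X⟧) := by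
    rw [two_mul, prod_range_add, prod_mul_distrib]
    have h1 : ∏ k ∈ range n, ((X : ℤ⟦X⟧) ^ (3 * n) + X * (X ^ 3) ^ k) =
        X ^ (∑ k ∈ range n, (3 * k + 1)) * ∏ k ∈ range n, (1 + X ^ (3 * k + 2) : ℤ⟦X⟧) := by
      rw [← prod_pow_eq_pow_sum, ← prod_range_reflect (fun k ↦ (1 + X ^ (3 * k + 2) : ℤ⟦X⟧)),
        ← prod_mul_distrib]
      refine prod_congr rfl fun k hk ↦ ?_
      obtain ⟨l, rfl⟩ : ∃ l, n = k + l + 1 :=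
        ⟨n - k - 1, by have := mem_range.mp hk; omega⟩
      rw [show k + l + 1 - 1 - k = l by omega]
      ring
    have h2 : ∏ k ∈ range n, ((X : ℤ⟦X⟧) ^ (3 * n) + X * (X ^ 3) ^ (n + k)) =
        X ^ (3 * n * n) * ∏ k ∈ range n, (1 + X ^ (3 * k + 1) : ℤ⟦X⟧) := by
      rw [pow_mul X (3 * n) n, ← card_range n, ← prod_const, card_range, ← prod_mul_distrib]
      exact prod_congr rfl fun k _ ↦ by ring
    rw [h1, h2, hN]
    ring
  rw [← hl, rothe, mul_sum]
  refine sum_congr rfl fun ij hij ↦ ?_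
  obtain ⟨i, j⟩ := ij
  rw [HasAntidiagonal.mem_antidiagonal] at hij
  have hexp : 3 * j.choose 2 + j + 3 * n * i = N + pentagonal ((j : ℤ) - n) := by
    have hp := two_mul_natCast_pentagonal ((j : ℤ) - n)
    have hc : 2 * (j.choose 2 : ℤ) = j * (j - 1) := by
      rcases j with _ | j
      · simp
      · have := Nat.add_one_mul_choose_eq j 1
        simp only [Nat.choose_one_right] at this
        push_cast
        zify at this
        linarith
    have hi : (i : ℤ) = 2 * n - j := by simp only at hij; omega
    zify
    refine mul_left_cancel₀ (two_ne_zero (α := ℤ)) ?_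
    rw [hi]
    linear_combination 3 * hc - hN2 - hp
  calc _ = gaussBinom (X ^ 3) i j * (X : ℤ⟦X⟧) ^ (3 * j.choose 2 + j + 3 * n * i) := by ring
    _ = _ := by rw [hexp]; ring

/-! ### Partial products and limits -/

open PowerSeries

theorem tendsto_iff_eventually_coeff_eq {u : ℕ → ℤ⟦X⟧} {v : ℤ⟦X⟧} :
    Tendsto u atTop (𝓝 v) ↔ ∀ d, ∀ᶠ n in atTop, coeff d (u n) = coeff d v := by
  simp [WithPiTopology.tendsto_iff_coeff_tendsto, nhds_discrete]

/-- The partial product `∏_{k < n} (1 - q ^ (j (k + 1)))` of `eulerProd j`. -/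
noncomputable def partialProd (j n : ℕ) : ℤ⟦X⟧ :=
  ∏ k ∈ range n, (1 - X ^ (j * (k + 1)))

theorem tendsto_partialProd (j : ℕ+) : Tendsto (partialProd j) atTop (𝓝 (eulerProd j)) :=
  (multipliable_eulerProd j).hasProd.tendsto_prod_nat

theorem X_pow_dvd_eulerProd_sub_partialProd (j : ℕ+) {N m : ℕ} (h : N ≤ j * (m + 1)) :
    (X : ℤ⟦X⟧) ^ N ∣ eulerProd j - partialProd j m := by
  have step : ∀ M, m ≤ M → (X : ℤ⟦X⟧) ^ N ∣ partialProd j M - partialProd j m := by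
    intro M hM
    induction M, hM using Nat.le_induction with
    | base => simp
    | succ M hM ih =>
      have : partialProd j (M + 1) - partialProd j m =
          (partialProd j M - partialProd j m) - partialProd j M * X ^ ((j : ℕ) * (M + 1)) := by
        rw [partialProd, prod_range_succ, ← partialProd]
        ring
      rw [this]
      refine ih.sub (Dvd.dvd.mul_left (pow_dvd_pow _ (h.trans ?_)) _)
      gcongr
  rw [X_pow_dvd_iff]
  intro d hd
  obtain ⟨M, hM, hmM⟩ :=
    ((tendsto_iff_eventually_coeff_eq.mp (tendsto_partialProd j) d).and
      (eventually_ge_atTop m)).exists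
  rw [map_sub, ← hM, ← map_sub]
  exact X_pow_dvd_iff.mp (step M hmM) d hd

/-- The coefficientwise limit of `[i + j, j]` in base `q ^ 3` is `1 / f_3`, with the precision
controlled by the smaller of `i` and `j`. -/
theorem X_pow_dvd_gaussBinom_mul_eulerProd_sub_one {N i j : ℕ} (hi : N ≤ 3 * (i + 1))
    (hj : N ≤ 3 * (j + 1)) :
    (X : ℤ⟦X⟧) ^ N ∣ gaussBinom (X ^ 3) i j * eulerProd 3 - 1 := by
  have hG := gaussBinom_mul_prod_mul_prod ((X : ℤ⟦X⟧) ^ 3) i j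
  simp only [← pow_mul] at hG
  change _ * partialProd (3 : ℕ+) i * partialProd (3 : ℕ+) j = partialProd (3 : ℕ+) (i + j) at hG
  obtain ⟨a, ha⟩ := X_pow_dvd_eulerProd_sub_partialProd 3 (N := N) (m := i) hi
  obtain ⟨b, hb⟩ := X_pow_dvd_eulerProd_sub_partialProd 3 (N := N) (m := j) hj
  obtain ⟨c, hc⟩ := X_pow_dvd_eulerProd_sub_partialProd 3 (N := N) (m := i + j)
    (hi.trans (by simp))
  -- Modulo `q ^ N` the three partial products are all equal to the unit `f_3`.
  rw [← (isUnit_eulerProd 3).dvd_mul_left]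
  rw [sub_eq_iff_eq_add', ← sub_eq_iff_eq_add] at ha hb hc
  rw [← ha, ← hb, ← hc] at hG
  refine ⟨gaussBinom (X ^ 3) i j * (a * eulerProd 3 + b * eulerProd 3 - X ^ N * a * b) - c, ?_⟩
  linear_combination hG

/-! ### The unsigned pentagonal series -/

open Classical in
/-- The theta series `∑_{t ∈ ℤ} q ^ (t (3 t - 1) / 2)`. -/
noncomputable def unsignedPentagonalSeries : ℤ⟦X⟧ :=
  .mk fun n ↦ if ∃ t, pentagonal t = n then 1 else 0

theorem natAbs_le_pentagonal (t : ℤ) : t.natAbs ≤ pentagonal t := by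
  have h := two_mul_natCast_pentagonal t
  zify
  rcases lt_trichotomy t 0 with ht | rfl | ht
  · rw [abs_of_neg ht]
    nlinarith
  · simp
  · rw [abs_of_pos ht]
    nlinarith

theorem coeff_sum_antidiagonal_X_pow_pentagonal {d n : ℕ} (h : d ≤ n) :
    coeff d (∑ ij ∈ antidiagonal (2 * n), (X : ℤ⟦X⟧) ^ pentagonal ((ij.2 : ℤ) - n)) =
      coeff d unsignedPentagonalSeries := by
  classical
  simp only [map_sum, coeff_X_pow, unsignedPentagonalSeries, coeff_mk]
  split_ifs with ht
  · obtain ⟨t, rfl⟩ := ht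
    have := (natAbs_le_pentagonal t).trans h
    rw [sum_eq_single_of_mem ((n - t).toNat, (n + t).toNat)]
    · rw [if_pos]
      congr 1
      omega
    · rw [HasAntidiagonal.mem_antidiagonal]
      omega
    · rintro ⟨i, j⟩ hij hne
      refine if_neg fun he ↦ hne ?_
      rw [HasAntidiagonal.mem_antidiagonal] at hij
      have := pentagonal_injective he
      simp only at this hij
      ext <;> simp only <;> omega
  · exact sum_eq_zero fun ij _ ↦ if_neg fun he ↦ ht ⟨_, he.symm⟩

theorem tendsto_prod_one_add_X_pow_mul_eulerProd :
    Tendsto (fun n ↦ (∏ k ∈ range n, ((1 + X ^ (3 * k + 1)) * (1 + X ^ (3 * k + 2)) : ℤ⟦X⟧)) *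
      eulerProd 3) atTop (𝓝 unsignedPentagonalSeries) := by
  rw [tendsto_iff_eventually_coeff_eq]
  intro d
  filter_upwards [eventually_ge_atTop d] with n hn
  rw [← coeff_sum_antidiagonal_X_pow_pentagonal hn, ← sub_eq_zero, ← map_sub]
  refine X_pow_dvd_iff.mp (?_ : X ^ (n + 1) ∣ _) d (by omega)
  rw [prod_one_add_X_pow_eq_sum_gaussBinom, sum_mul, ← sum_sub_distrib]
  refine dvd_sum fun ⟨i, j⟩ hij ↦ ?_
  rw [HasAntidiagonal.mem_antidiagonal] at hij
  have hp := natAbs_le_pentagonal ((j : ℤ) - n)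
  -- Here `min i j = n - |j - n|`, so the bound `|t| ≤ pentagonal t` makes up exactly for the
  -- precision lost away from the middle of the row.
  have hd := mul_dvd_mul (X_pow_dvd_gaussBinom_mul_eulerProd_sub_one (i := i) (j := j)
    (N := min i j + 1) (by omega) (by omega)) (dvd_refl ((X : ℤ⟦X⟧) ^ pentagonal ((j : ℤ) - n)))
  rw [← pow_add] at hd
  convert (pow_dvd_pow X ?_).trans hd using 1
  · ring
  · simp only at hij
    omega

/-- Splitting `∏_{k < 3 n} (1 + q ^ (k + 1))` by the residue of `k` modulo `3`, with denominators
cleared. -/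
theorem prod_one_add_X_pow_mul_partialProd (n : ℕ) :
    (∏ k ∈ range n, ((1 + X ^ (3 * k + 1)) * (1 + X ^ (3 * k + 2)) : ℤ⟦X⟧)) *
      partialProd 6 n * partialProd 1 (3 * n) = partialProd 2 (3 * n) * partialProd 3 n := by
  induction n with
  | zero => simp [partialProd]
  | succ n ih =>
    simp only [partialProd, mul_add, prod_range_succ, mul_one] at ih ⊢
    linear_combination (1 + X ^ (3 * n + 1)) * (1 + X ^ (3 * n + 2)) * (1 - X ^ (6 * n + 6)) *
      (1 - X ^ (3 * n + 1)) * (1 - X ^ (3 * n + 2)) * (1 - X ^ (3 * n + 3)) * ih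

/-- The product formula `∑_{t ∈ ℤ} q ^ (t (3 t - 1) / 2) = f_2 f_3 ^ 2 / (f_1 f_6)`, with
denominators cleared. -/
theorem unsignedPentagonalSeries_mul :
    unsignedPentagonalSeries * eulerProd 6 * eulerProd 1 = eulerProd 2 * eulerProd 3 ^ 2 := by
  have h3 : Tendsto (fun n : ℕ ↦ 3 * n) atTop atTop := tendsto_id.const_mul_atTop' (by simp)
  have hl := (tendsto_prod_one_add_X_pow_mul_eulerProd.mul (tendsto_partialProd 6)).mul
    ((tendsto_partialProd 1).comp h3)
  have hr := (((tendsto_partialProd 2).comp h3).mul (tendsto_partialProd 3)).mul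
    (tendsto_const_nhds (x := eulerProd 3))
  rw [pow_two, ← mul_assoc]
  refine tendsto_nhds_unique (hl.congr fun n ↦ ?_) hr
  have := prod_one_add_X_pow_mul_partialProd n
  simp only [Function.comp_apply, PNat.val_ofNat]
  linear_combination eulerProd 3 * this

theorem eulerProd_one : eulerProd 1 = pentagonalSeries ℤ := by
  simpa [eulerProd] using (WithPiTopology.hasProd_one_sub_X_pow ℤ).tprod_eq

/-! ### Congruences -/

theorem map_eulerProd_sq (j : ℕ+) :
    PowerSeries.map (Int.castRingHom (ZMod 2)) (eulerProd j) ^ 2 =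
      PowerSeries.map (Int.castRingHom (ZMod 2)) (eulerProd (2 * j)) := by
  have hn (n : ℕ) : PowerSeries.map (Int.castRingHom (ZMod 2)) (partialProd j n ^ 2) =
      PowerSeries.map (Int.castRingHom (ZMod 2)) (partialProd (2 * j : ℕ+) n) := by
    have h2 : (2 : (ZMod 2)⟦X⟧) = 0 := by
      rw [← map_ofNat (C (R := ZMod 2)) 2, show (OfNat.ofNat 2 : ZMod 2) = 0 from rfl, map_zero]
    simp only [partialProd, map_pow, map_prod, map_sub, map_one, PowerSeries.map_X, ← prod_pow]
    refine prod_congr rfl fun k _ ↦ ?_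
    push_cast
    linear_combination (X ^ ((j : ℕ) * (k + 1) * 2) - X ^ ((j : ℕ) * (k + 1))) * h2
  ext d
  obtain ⟨n, h1, h2⟩ :=
    ((tendsto_iff_eventually_coeff_eq.mp ((tendsto_partialProd j).pow 2) d).and
      (tendsto_iff_eventually_coeff_eq.mp (tendsto_partialProd (2 * j)) d)).exists
  rw [← map_pow, coeff_map, coeff_map, ← h1, ← h2, ← coeff_map, ← coeff_map, hn]

theorem map_f_sq_div_f (j : ℕ+) :
    Units.map (PowerSeries.map (Int.castRingHom (ZMod 2))).toMonoidHom (f j ^ 2 / f (2 * j)) =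
      1 := by
  rw [map_div, map_pow, div_eq_one]
  ext1
  exact map_eulerProd_sq j

theorem exists_eq_one_add_two_mul {u : ℤ⟦X⟧ˣ}
    (h : Units.map (PowerSeries.map (Int.castRingHom (ZMod 2))).toMonoidHom u = 1) :
    ∃ g : ℤ⟦X⟧, (u : ℤ⟦X⟧) = 1 + 2 * g := by
  have h' : PowerSeries.map (Int.castRingHom (ZMod 2)) (u - 1 : ℤ⟦X⟧) = 0 := by
    rw [map_sub, map_one, sub_eq_zero]
    exact congrArg Units.val h
  have hd (d : ℕ) : (2 : ℤ) ∣ coeff d (u - 1 : ℤ⟦X⟧) := by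
    have := congrArg (coeff d) h'
    rw [coeff_map, map_zero, eq_intCast] at this
    exact (ZMod.intCast_zmod_eq_zero_iff_dvd _ 2).mp this
  choose g hg using hd
  refine ⟨.mk g, ?_⟩
  rw [← sub_eq_iff_eq_add', ← map_ofNat (C (R := ℤ)) 2]
  ext d
  rw [hg, coeff_C_mul, coeff_mk]

theorem exists_seriesA_eq (S : Finset ℕ+) (e : ℕ+ → ℤ) :
    ∃ h : ℤ⟦X⟧, (seriesA S e : ℤ⟦X⟧) = eulerProd 1 * (1 + 2 * h) := by
  obtain ⟨h, hh⟩ := exists_eq_one_add_two_mul (u := ∏ j ∈ S, (f j ^ 2 / f (2 * j)) ^ e j)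
    (by simp only [map_prod, map_zpow, map_f_sq_div_f, one_zpow, prod_const_one])
  exact ⟨h, by rw [← hh]; rfl⟩

/-- Modulo `4`, the difference `B - A` is the unsigned minus the signed pentagonal series. -/
theorem exists_seriesB_sub_seriesA_eq (S : Finset ℕ+) (e : ℕ+ → ℤ) :
    ∃ g : ℤ⟦X⟧, (seriesB S e : ℤ⟦X⟧) - seriesA S e =
      unsignedPentagonalSeries - eulerProd 1 + 4 * g := by
  obtain ⟨h, hA⟩ := exists_seriesA_eq S e
  obtain ⟨k, hk⟩ := exists_eq_one_add_two_mul (map_f_sq_div_f 1)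
  obtain ⟨l, hl⟩ := exists_eq_one_add_two_mul (map_f_sq_div_f 3)
  have hk' : (1 + 2 * k) * eulerProd 2 = eulerProd 1 ^ 2 := by
    rw [← hk]
    exact congrArg Units.val (div_mul_cancel (f 1 ^ 2) (f 2))
  have hl' : (1 + 2 * l) * eulerProd 6 = eulerProd 3 ^ 2 := by
    rw [← hl]
    exact congrArg Units.val (div_mul_cancel (f 3 ^ 2) (f 6))
  have hB : (seriesB S e : ℤ⟦X⟧) = seriesA S e * ((1 + 2 * k) * (1 + 2 * l)) := by
    rw [← hk, ← hl, seriesB, mul_div_mul_comm]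
    rfl
  have hθ : eulerProd 1 * ((1 + 2 * k) * (1 + 2 * l)) =
      unsignedPentagonalSeries * (1 + 2 * k) ^ 2 := by
    refine ((isUnit_eulerProd 2).mul (isUnit_eulerProd 6)).mul_right_cancel ?_
    refine (isUnit_eulerProd 1).mul_right_cancel ?_
    linear_combination (eulerProd 1 ^ 2 * (1 + 2 * k) * eulerProd 2) * hl' -
      (1 + 2 * k) ^ 2 * eulerProd 2 * unsignedPentagonalSeries_mul -
      (1 + 2 * k) * eulerProd 2 * eulerProd 3 ^ 2 * hk'
  refine ⟨unsignedPentagonalSeries * (k + k ^ 2) + eulerProd 1 * h * (k + l + 2 * k * l), ?_⟩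
  rw [hB, hA]
  linear_combination hθ

theorem coeff_seriesA_modEq (S : Finset ℕ+) (e : ℕ+ → ℤ) (n : ℕ) :
    a S e n ≡ coeff n (pentagonalSeries ℤ) [ZMOD 2] := by
  obtain ⟨h, hA⟩ := exists_seriesA_eq S e
  rw [a, hA, mul_add, mul_one, mul_left_comm, ← map_ofNat (C (R := ℤ)) 2, map_add, coeff_C_mul,
    eulerProd_one]
  exact (Int.modEq_iff_dvd.mpr (by simp)).symm

theorem b_modEq (S : Finset ℕ+) (e : ℕ+ → ℤ) (n : ℕ) :
    b S e n ≡ a S e n + (coeff n unsignedPentagonalSeries - coeff n (pentagonalSeries ℤ))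
      [ZMOD 4] := by
  obtain ⟨g, hg⟩ := exists_seriesB_sub_seriesA_eq S e
  have := congrArg (coeff n) hg
  rw [← map_ofNat (C (R := ℤ)) 4, map_add, map_sub, map_sub, coeff_C_mul, eulerProd_one] at this
  refine (Int.modEq_iff_dvd.mpr ⟨coeff n g, ?_⟩).symm
  rw [a, b]
  linear_combination this

end EtaQuotient

open EtaQuotient in
theorem mainTheorem5 (S : Finset ℕ+) (e : ℕ+ → ℤ) (n : ℕ) :
    ((EtaQuotient.a S e n ≡ 0 [ZMOD 2] ∨ ∃ t : ℤ, Even t ∧ (n : ℤ) = t * (3 * t - 1) / 2) →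
      EtaQuotient.b S e n ≡ EtaQuotient.a S e n [ZMOD 4]) ∧
    ((∃ t : ℤ, Odd t ∧ (n : ℤ) = t * (3 * t - 1) / 2) →
      EtaQuotient.b S e n ≡ EtaQuotient.a S e n + 2 [ZMOD 4]) := by
  have hb := b_modEq S e n
  have hpent {t : ℤ} (h : (n : ℤ) = t * (3 * t - 1) / 2) : pentagonal t = n := by
    rw [← natCast_pentagonal] at h
    exact_mod_cast h.symm
  have hθ (t : ℤ) : PowerSeries.coeff (pentagonal t) unsignedPentagonalSeries = 1 := by
    rw [unsignedPentagonalSeries, PowerSeries.coeff_mk, if_pos ⟨t, rfl⟩]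
  refine ⟨?_, ?_⟩
  · rintro (ha | ⟨t, ht, hn⟩)
    · have hnp : ¬ ∃ t, pentagonal t = n := by
        rintro ⟨t, rfl⟩
        have h := (coeff_seriesA_modEq S e (pentagonal t)).symm.trans ha
        rw [PowerSeries.coeff_pentagonalSeries_pentagonal] at h
        rcases Int.even_or_odd t with ht | ht
        · simp [Int.negOnePow_even t ht, Int.ModEq] at h
        · simp [Int.negOnePow_odd t ht, Int.ModEq] at h
      rwa [PowerSeries.coeff_pentagonalSeries_eq_zero ℤ hnp, unsignedPentagonalSeries,
        PowerSeries.coeff_mk, if_neg hnp, sub_zero, add_zero] at hb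
    · obtain rfl := hpent hn
      simpa [hθ, Int.negOnePow_even t ht] using hb
  · rintro ⟨t, ht, hn⟩
    obtain rfl := hpent hn
    simpa [hθ, Int.negOnePow_odd t ht] using hb
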